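/- Let $n\ge 1$ and $k\ge 1$ be integers. Let $G_{n,k}$ be the group presented as follows. The generators are the symbols $\sigma_i^{\mathbf a}$, where $1\le i\le n-1$ and $\mathbf a=(a_1,\dots,a_{i+1})$ is a sequence with $1\le a_j\le k-1$ for all $j$. The relations are, for all sequences with entries in $\{1,\dots,k-1\}$: (0) $\sigma_i^{a_1\dots a_{i-1}a_i a_i}=1$ and $\left(\sigma_i^{a_1\dots a_{i-1}a_ia_{i+1}}\right)^{-1}=\sigma_i^{a_1\dots a_{i-1}a_{i+1}a_i}$ for $1\le i\le n-1$; (1) (pseudo-commutative relations) for $1\le i$, $i+2\le j\le n-1$, $$\sigma_j^{a_1\dots a_{j+1}}\,\sigma_i^{a_1\dots a_{i+1}}=\sigma_i^{a_1\dots a_{i+1}}\,\sigma_j^{a_1\dots a_{i-1}a_{i+1}a_ia_{i+2}\dots a_{j+1}};$$ (2) (pseudo-braid relations) for $1\le i\le n-2$, $$\sigma_{i+1}^{a_1\dots a_{i-1}a_ia_{i+1}a_{i+2}}\,\sigma_i^{a_1\dots a_{i-1}a_ia_{i+2}}\,\sigma_{i+1}^{a_1\dots a_{i-1}a_{i+2}a_ia_{i+1}}=\sigma_i^{a_1\dots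 a_{i-1}a_ia_{i+1}}\,\sigma_{i+1}^{a_1\dots a_{i-1}a_{i+1}a_ia_{i+2}}\,\sigma_i^{a_1\dots a_{i-1}a_{i+1}a_{i+2}}.$$ Then $G_{n,k}$ is a free group of rank $$N_1(n,k)=(k-2)\binom{n+k-2}{n-1}-\binom{n+k-2}{n}+1,$$ and the elements $\sigma_i^{\mathbf a}$ with $1\le i\le n-1$, $a_1\le a_2\le\dots\le a_{i-1}\le a_{i+1}$ and $a_i<a_{i+1}$ form a free basis of $G_{n,k}$. (For $i=1$ the condition is just $a_1<a_2$.) -/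

import Mathlib

/-- The symbols `σ_i^{a_1 … a_{i+1}}` with `1 ≤ i ≤ n - 1` and entries in the `k - 1` leaves
`1, …, k - 1` (modelled, with their order, by `Fin (k - 1)`).
The sequence `a_1 … a_{i+1}` is recorded as its initial part `a_1 … a_{i-1}` (`init`), followed by
`a_i` (`fst`) and `a_{i+1}` (`snd`); thus `i = init.length + 1`, and `i + 1 ≤ n`. -/
@[ext]
structure StarGen (n k : ℕ) where
  init : List (Fin (k - 1))
  fst : Fin (k - 1)
  snd : Fin (k - 1)
  length_le : init.length + 2 ≤ n

namespace StarGen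

/-- The letter of the free group that belongs to the sequence `p, x, y`. -/
def letter {n k : ℕ} (p : List (Fin (k - 1))) (x y : Fin (k - 1)) (h : p.length + 2 ≤ n) :
    FreeGroup (StarGen n k) :=
  FreeGroup.of ⟨p, x, y, h⟩

/-- The defining relations `l = r` of the group `G_{n,k}`. -/
inductive Rel (n k : ℕ) : FreeGroup (StarGen n k) → FreeGroup (StarGen n k) → Prop
  /-- `σ_i^{p,x,x} = 1`. -/
  | diag (p : List (Fin (k - 1))) (x : Fin (k - 1)) (h : p.length + 2 ≤ n) :
      Rel n k (letter p x x h) 1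
  /-- `(σ_i^{p,x,y})⁻¹ = σ_i^{p,y,x}`. -/
  | inv (p : List (Fin (k - 1))) (x y : Fin (k - 1)) (h : p.length + 2 ≤ n) :
      Rel n k (letter p x y h)⁻¹ (letter p y x h)
  /-- Pseudo-commutative relation
  `σ_j^{p,x,y,q,z,w} σ_i^{p,x,y} = σ_i^{p,x,y} σ_j^{p,y,x,q,z,w}`:
  here `i = p.length + 1` and `j = p.length + q.length + 3`, so that `i` and `j` are arbitrary
  with `1 ≤ i`, `i + 2 ≤ j` and `j + 1 ≤ n`. -/
  | pseudoComm (p q : List (Fin (k - 1))) (x y z w : Fin (k - 1))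
      (hi : p.length + 2 ≤ n)
      (hj : (p ++ [x, y] ++ q).length + 2 ≤ n) (hj' : (p ++ [y, x] ++ q).length + 2 ≤ n) :
      Rel n k
        (letter (p ++ [x, y] ++ q) z w hj * letter p x y hi)
        (letter p x y hi * letter (p ++ [y, x] ++ q) z w hj')
  /-- Pseudo-braid relation
  `σ_{i+1}^{p,x,y,z} σ_i^{p,x,z} σ_{i+1}^{p,z,x,y} = σ_i^{p,x,y} σ_{i+1}^{p,y,x,z} σ_i^{p,y,z}`:
  here `i = p.length + 1` is arbitrary with `1 ≤ i` and `i + 2 ≤ n`. -/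
  | pseudoBraid (p : List (Fin (k - 1))) (x y z : Fin (k - 1))
      (h : p.length + 2 ≤ n)
      (hx : (p ++ [x]).length + 2 ≤ n) (hy : (p ++ [y]).length + 2 ≤ n)
      (hz : (p ++ [z]).length + 2 ≤ n) :
      Rel n k
        (letter (p ++ [x]) y z hx * letter p x z h * letter (p ++ [z]) x y hz)
        (letter p x y h * letter (p ++ [y]) x z hy * letter p y z h)

/-- `a_1 ≤ … ≤ a_{i-1} ≤ a_{i+1}` and `a_i < a_{i+1}`. -/
def IsBasic {n k : ℕ} (g : StarGen n k) : Prop :=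
  (g.init ++ [g.snd]).Pairwise (· ≤ ·) ∧ g.fst < g.snd

end StarGen

/-- The group `G_{n,k}` presented by the symbols `σ_i^a` and the relations above. -/
abbrev StarGroup (n k : ℕ) : Type :=
  PresentedGroup {r : FreeGroup (StarGen n k) | ∃ u v, StarGen.Rel n k u v ∧ r = u * v⁻¹}

/-- The element of `G_{n,k}` given by the symbol `σ_i^a`. -/
def StarGroup.sigma {n k : ℕ} (g : StarGen n k) : StarGroup n k :=
  PresentedGroup.of g

/-- `N₁(n,k) = (k-2) C(n+k-2, n-1) - C(n+k-2, n) + 1`, for `n, k ≥ 1`. -/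
def starRank (n k : ℕ) : ℤ :=
  ((k : ℤ) - 2) * ((n + k - 2).choose (n - 1) : ℤ) - ((n + k - 2).choose n : ℤ) + 1

/-! Words form a permutation graph whose edges are adjacent transpositions. Send `σ^{p,x,y}` to the
difference of a potential `Φ` between `p x y` and `p y x`. Appending a letter multiplies `Φ` on the
left by a factor depending only on the multiset of earlier letters, so such differences satisfy
every relation (`lift_value_eq_of_rel`). The factors are chosen so that each basic symbol goes to
its own free generator (`value_of_isBasic`); hence the basic symbols are free in the group. They
generate it by `sigma_mem_of_basic`: pseudo-commutation sorts the initial part and pseudo-braids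
remove too large a letter from it, modulo shorter symbols. -/

namespace StarGen

/-! ### Potential on words and the relations -/

variable {n k : ℕ}

/-- The free generator attached to `p, x, y` if this sequence is basic, and `1` otherwise. -/
noncomputable def basicLetter (n : ℕ) {k : ℕ} (p : List (Fin (k - 1))) (x y : Fin (k - 1)) :
    FreeGroup {g : StarGen n k // g.IsBasic} :=
  open Classical in
  if h : ∃ hl : p.length + 2 ≤ n, IsBasic (⟨p, x, y, hl⟩ : StarGen n k) then
    FreeGroup.of ⟨⟨p, x, y, h.1⟩, h.2⟩
  else 1

theorem basicLetter_of_isBasic (g : StarGen n k) (hg : g.IsBasic) :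
    basicLetter n g.init g.fst g.snd = FreeGroup.of ⟨g, hg⟩ :=
  dif_pos (⟨g.length_le, hg⟩ : ∃ hl : g.init.length + 2 ≤ n,
    IsBasic (⟨g.init, g.fst, g.snd, hl⟩ : StarGen n k))

theorem basicLetter_of_le {p : List (Fin (k - 1))} {x y : Fin (k - 1)} (h : y ≤ x) :
    basicLetter n p x y = 1 :=
  dif_neg fun ⟨_, hb⟩ => absurd hb.2 h.not_gt

/-- The product, over the initial segments `p, y` of the reversal of a list, of the letters
`p, x, y`. -/
noncomputable def insertList (n : ℕ) {k : ℕ} (x : Fin (k - 1)) :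
    List (Fin (k - 1)) → FreeGroup {g : StarGen n k // g.IsBasic}
  | [] => 1
  | y :: L => insertList n x L * basicLetter n L.reverse x y

theorem insertList_eq_one {x : Fin (k - 1)} :
    ∀ {L : List (Fin (k - 1))}, (∀ a ∈ L, a ≤ x) → insertList n x L = 1
  | [], _ => rfl
  | y :: L, h => by
    rw [insertList, insertList_eq_one fun a ha => h a (by simp [ha]),
      basicLetter_of_le (h y (by simp)), one_mul]

/-- The change of potential when the letter `x` is appended to a word with multiset of letters
`M`. -/
noncomputable def insertion (n : ℕ) {k : ℕ} (M : Multiset (Fin (k - 1))) (x : Fin (k - 1)) :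
    FreeGroup {g : StarGen n k // g.IsBasic} :=
  insertList n x (M.sort (· ≥ ·))

theorem insertion_eq_one {M : Multiset (Fin (k - 1))} {x : Fin (k - 1)} (h : ∀ a ∈ M, a ≤ x) :
    insertion n M x = 1 :=
  insertList_eq_one fun a ha => h a (by simpa using ha)

/-- The change of potential when a word is appended to a word with multiset of letters `M`. -/
noncomputable def potentialFrom (n : ℕ) {k : ℕ} :
    Multiset (Fin (k - 1)) → List (Fin (k - 1)) → FreeGroup {g : StarGen n k // g.IsBasic}
  | _, [] => 1
  | M, x :: q => potentialFrom n (x ::ₘ M) q * insertion n M x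

theorem potentialFrom_append (u q : List (Fin (k - 1))) (M : Multiset (Fin (k - 1))) :
    potentialFrom n M (u ++ q) = potentialFrom n (M + (u : Multiset (Fin (k - 1)))) q * potentialFrom n M u := by
  induction u generalizing M with
  | nil => simp [potentialFrom]
  | cons x u ih =>
    have h : x ::ₘ M + (u : Multiset (Fin (k - 1))) = M + ↑(x :: u) := by
      rw [← Multiset.cons_coe, Multiset.add_cons, Multiset.cons_add]
    rw [List.cons_append, potentialFrom, ih, potentialFrom, h, mul_assoc]

/-- A potential on words, trivial on sorted words, whose differences along adjacent
transpositions are the values of the symbols in the free group on the basic symbols. -/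
noncomputable def potential (n : ℕ) {k : ℕ} (w : List (Fin (k - 1))) :
    FreeGroup {g : StarGen n k // g.IsBasic} :=
  potentialFrom n 0 w

theorem potential_append (u q : List (Fin (k - 1))) :
    potential n (u ++ q) = potentialFrom n (↑u) q * potential n u := by
  simp [potential, potentialFrom_append]

theorem potential_append_singleton (u : List (Fin (k - 1))) (x : Fin (k - 1)) :
    potential n (u ++ [x]) = insertion n (↑u) x * potential n u := by
  simp [potential_append, potentialFrom]

theorem potential_of_pairwise (w : List (Fin (k - 1))) (hw : w.Pairwise (· ≤ ·)) :
    potential n w = 1 := by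
  induction w using List.reverseRecOn with
  | nil => rfl
  | append_singleton u x ih =>
    rw [List.pairwise_append] at hw
    rw [potential_append_singleton, ih hw.1, mul_one,
      insertion_eq_one fun a ha => hw.2.2 a (by simpa using ha) x (by simp)]

/-- The value of a symbol in the free group on the basic symbols. -/
noncomputable def value (g : StarGen n k) : FreeGroup {g : StarGen n k // g.IsBasic} :=
  (potential n (g.init ++ [g.fst, g.snd]))⁻¹ * potential n (g.init ++ [g.snd, g.fst])

theorem sort_ge_coe {p : List (Fin (k - 1))} (hp : p.Pairwise (· ≤ ·)) :
    (p : Multiset (Fin (k - 1))).sort (· ≥ ·) = p.reverse := by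
  refine List.Perm.eq_of_pairwise' (r := (· ≥ ·)) (Multiset.pairwise_sort _ _)
    (List.pairwise_reverse.2 hp) ?_
  rw [← Multiset.coe_eq_coe, Multiset.sort_eq, Multiset.coe_eq_coe]
  exact (List.reverse_perm p).symm

/-- Since `g.snd` bounds `g.init`, it comes first in the decreasing sort, so its presence adds
exactly one last factor to the insertion of `g.fst`: the letter of `g`. -/
theorem value_of_isBasic (g : StarGen n k) (hg : g.IsBasic) :
    value g = FreeGroup.of ⟨g, hg⟩ := by
  obtain ⟨hs, hlt⟩ := id hg
  have hs' := List.pairwise_append.1 hs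
  have hp : potential n g.init = 1 := potential_of_pairwise _ hs'.1
  have hle : ∀ a ∈ g.init, a ≤ g.snd := fun a ha => hs'.2.2 a ha _ (by simp)
  have e1 : g.init ++ [g.fst, g.snd] = (g.init ++ [g.fst]) ++ [g.snd] := by simp
  have e2 : g.init ++ [g.snd, g.fst] = (g.init ++ [g.snd]) ++ [g.fst] := by simp
  have h1 : potential n (g.init ++ [g.fst, g.snd]) = insertion n ↑g.init g.fst := by
    rw [e1, potential_append_singleton, potential_append_singleton, hp, mul_one,
      insertion_eq_one, one_mul]
    intro a ha
    rw [Multiset.mem_coe, List.mem_append, List.mem_singleton] at ha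
    rcases ha with ha | rfl
    · exact hle a ha
    · exact hlt.le
  have h2 : potential n (g.init ++ [g.snd, g.fst]) =
      insertion n ↑g.init g.fst * basicLetter n g.init g.fst g.snd := by
    rw [e2, potential_append_singleton, potential_of_pairwise _ hs, mul_one, insertion, insertion,
      sort_ge_coe hs, sort_ge_coe hs'.1]
    simp [insertList]
  rw [value, h1, h2, inv_mul_cancel_left, basicLetter_of_isBasic g hg]

theorem lift_value_eq_of_rel {u v : FreeGroup (StarGen n k)} (h : Rel n k u v) :
    FreeGroup.lift value u = FreeGroup.lift value v := by
  cases h with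
  | diag p x h => simp [letter, value]
  | inv p x y h => simp [letter, value]
  | pseudoComm p q x y z w hi hj hj' =>
    have hM : ((p ++ [x, y] : List (Fin (k - 1))) : Multiset (Fin (k - 1))) = ↑(p ++ [y, x]) :=
      Multiset.coe_eq_coe.2 ((List.Perm.swap y x []).append_left p)
    simp only [letter, map_mul, FreeGroup.lift_apply_of, value]
    -- Split each word after the exchanged pair: the two tails contribute equal factors, so the two
    -- values of `σ_j` are conjugate by the value of `σ_i`.
    rw [List.append_assoc (p ++ [x, y]), List.append_assoc (p ++ [x, y]),
      List.append_assoc (p ++ [y, x]), List.append_assoc (p ++ [y, x]),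
      potential_append (p ++ [x, y]), potential_append (p ++ [x, y]),
      potential_append (p ++ [y, x]), potential_append (p ++ [y, x]), hM]
    group
  | pseudoBraid p x y z h hx hy hz =>
    have key : ∀ a b c : Fin (k - 1), potential n ((p ++ [a]) ++ [b, c]) =
        insertion n (↑(p ++ [a, b])) c * potential n (p ++ [a, b]) := fun a b c => by
      rw [← potential_append_singleton]; simp
    have swap : ∀ a b : Fin (k - 1),
        ((p ++ [a, b] : List (Fin (k - 1))) : Multiset (Fin (k - 1))) = ↑(p ++ [b, a]) :=
      fun a b => Multiset.coe_eq_coe.2 ((List.Perm.swap b a []).append_left p)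
    -- Both sides telescope along the hexagon of orderings of `x, y, z`, from `p x y z` to `p z y
    -- x`; the third letter's factor ignores the order of the first two and cancels.
    simp only [letter, map_mul, FreeGroup.lift_apply_of, value, key]
    rw [swap z x, swap y x, swap z y]
    group

end StarGen

/-! ### Isomorphism with the free group -/

namespace StarGroup

open StarGen

variable {n k : ℕ}

/-- The homomorphism to the free group on the basic symbols. -/
noncomputable def toFree (n k : ℕ) :
    StarGroup n k →* FreeGroup {g : StarGen n k // g.IsBasic} :=
  PresentedGroup.toGroup (f := value) (by
    rintro r ⟨u, v, h, rfl⟩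
    rw [map_mul, map_inv, lift_value_eq_of_rel h, mul_inv_cancel])

/-- The homomorphism from the free group on the basic symbols. -/
noncomputable def ofFree (n k : ℕ) :
    FreeGroup {g : StarGen n k // g.IsBasic} →* StarGroup n k :=
  FreeGroup.lift fun g => sigma g.1

theorem toFree_comp_ofFree :
    (toFree n k).comp (ofFree n k) = MonoidHom.id _ := by
  refine FreeGroup.ext_hom _ _ fun g => ?_
  simp [toFree, ofFree, sigma, value_of_isBasic g.1 g.2]

theorem mk_eq_of_rel {u v : FreeGroup (StarGen n k)} (h : Rel n k u v) :
    (PresentedGroup.mk _ u : StarGroup n k) = PresentedGroup.mk _ v := by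
  rw [← mul_inv_eq_one, ← map_inv, ← map_mul]
  exact PresentedGroup.one_of_mem ⟨u, v, h, rfl⟩

theorem sigma_diag (p : List (Fin (k - 1))) (x : Fin (k - 1)) (h : p.length + 2 ≤ n) :
    sigma ⟨p, x, x, h⟩ = 1 :=
  (mk_eq_of_rel (Rel.diag p x h)).trans (map_one _)

theorem sigma_inv (p : List (Fin (k - 1))) (x y : Fin (k - 1)) (h : p.length + 2 ≤ n) :
    (sigma ⟨p, x, y, h⟩)⁻¹ = sigma ⟨p, y, x, h⟩ :=
  mk_eq_of_rel (Rel.inv p x y h)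

theorem sigma_pseudoComm (p q : List (Fin (k - 1))) (x y z w : Fin (k - 1))
    (hi : p.length + 2 ≤ n) (hj : (p ++ [x, y] ++ q).length + 2 ≤ n)
    (hj' : (p ++ [y, x] ++ q).length + 2 ≤ n) :
    sigma ⟨p ++ [x, y] ++ q, z, w, hj⟩ * sigma ⟨p, x, y, hi⟩ =
      sigma ⟨p, x, y, hi⟩ * sigma ⟨p ++ [y, x] ++ q, z, w, hj'⟩ :=
  mk_eq_of_rel (Rel.pseudoComm p q x y z w hi hj hj')

theorem sigma_pseudoBraid (p : List (Fin (k - 1))) (x y z : Fin (k - 1)) (h : p.length + 2 ≤ n)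
    (hx : (p ++ [x]).length + 2 ≤ n) (hy : (p ++ [y]).length + 2 ≤ n)
    (hz : (p ++ [z]).length + 2 ≤ n) :
    sigma ⟨p ++ [x], y, z, hx⟩ * sigma ⟨p, x, z, h⟩ * sigma ⟨p ++ [z], x, y, hz⟩ =
      sigma ⟨p, x, y, h⟩ * sigma ⟨p ++ [y], x, z, hy⟩ * sigma ⟨p, y, z, h⟩ :=
  mk_eq_of_rel (Rel.pseudoBraid p x y z h hx hy hz)

/-- Modulo a subgroup containing the symbols with shorter initial part, the initial part may be
permuted. -/
theorem sigma_mem_of_perm {S : Subgroup (StarGroup n k)} {N : ℕ}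
    (ih : ∀ g : StarGen n k, g.init.length < N → sigma g ∈ S) {p p' : List (Fin (k - 1))}
    (hpp : p.Perm p') (r : List (Fin (k - 1))) (x y : Fin (k - 1))
    (hN : (r ++ p).length = N) (h : (r ++ p).length + 2 ≤ n) (h' : (r ++ p').length + 2 ≤ n)
    (hmem : sigma ⟨r ++ p', x, y, h'⟩ ∈ S) : sigma ⟨r ++ p, x, y, h⟩ ∈ S := by
  induction hpp generalizing r with
  | nil => exact hmem
  | cons a hp ihp =>
    have := ihp (r ++ [a]) (by simpa using hN) (by simpa using h) (by simpa using h')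
      (by simpa using hmem)
    simpa using this
  | swap a b l =>
    have hr : r.length + 2 ≤ n := by simp at h; omega
    have hrel := sigma_pseudoComm r l b a x y hr (by simpa using h) (by simpa using h')
    have hlow : sigma (⟨r, b, a, hr⟩ : StarGen n k) ∈ S := ih _ (by simp at hN ⊢; omega)
    -- Exchanging two adjacent initial letters is conjugation by a shorter symbol.
    have := eq_mul_inv_of_mul_eq hrel
    simp only [List.append_assoc, List.cons_append, List.nil_append] at this
    rw [this]
    exact S.mul_mem (S.mul_mem hlow hmem) (S.inv_mem hlow)
  | trans h12 h23 ih1 ih2 =>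
    have hl := h12.length_eq
    have h2 := h
    rw [List.length_append, hl, ← List.length_append] at h2
    refine ih1 r hN h h2 (ih2 r ?_ h2 h' hmem)
    rwa [List.length_append, ← hl, ← List.length_append]

/-- Strong induction on the length of the initial part; the only obstruction left after sorting is
an initial letter exceeding both final ones. -/
theorem sigma_mem_of_basic {S : Subgroup (StarGroup n k)}
    (hS : ∀ g : StarGen n k, g.IsBasic → sigma g ∈ S) :
    ∀ (N : ℕ) (g : StarGen n k), g.init.length = N → sigma g ∈ S := by
  intro N
  induction N using Nat.strong_induction_on with
  | _ N ih' =>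
  have ih : ∀ g : StarGen n k, g.init.length < N → sigma g ∈ S := fun g hg => ih' _ hg g rfl
  have perm : ∀ (p p' : List (Fin (k - 1))) (x y : Fin (k - 1)) (h : p.length + 2 ≤ n)
      (h' : p'.length + 2 ≤ n), p.Perm p' → p.length = N → sigma ⟨p', x, y, h'⟩ ∈ S →
      sigma ⟨p, x, y, h⟩ ∈ S := fun p p' x y h h' hpp hN hm =>
    sigma_mem_of_perm ih hpp [] x y hN h h' hm
  -- symbols all of whose initial letters are at most the larger letter `y`
  have dominated : ∀ (p : List (Fin (k - 1))) (x y : Fin (k - 1)) (h : p.length + 2 ≤ n),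
      p.length = N → x < y → (∀ a ∈ p, a ≤ y) → sigma ⟨p, x, y, h⟩ ∈ S := by
    intro p x y h hN hxy hle
    have hp : p.Perm ((p : Multiset (Fin (k - 1))).sort (· ≤ ·)) :=
      Multiset.coe_eq_coe.1 (Multiset.sort_eq _ _).symm
    refine perm p _ x y h (by rwa [← hp.length_eq]) hp hN (hS _ ⟨?_, hxy⟩)
    refine List.pairwise_append.2
      ⟨Multiset.pairwise_sort (p : Multiset (Fin (k - 1))) (· ≤ ·), by simp, ?_⟩
    intro a ha b hb
    rw [List.mem_singleton.1 hb]
    exact hle a (by simpa using ha)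
  have increasing : ∀ (p : List (Fin (k - 1))) (x y : Fin (k - 1)) (h : p.length + 2 ≤ n),
      p.length = N → x < y → sigma ⟨p, x, y, h⟩ ∈ S := by
    intro p x y h hN hxy
    by_cases hle : ∀ a ∈ p, a ≤ y
    · exact dominated p x y h hN hxy hle
    push Not at hle
    obtain ⟨b, hb, hyb⟩ := hle
    obtain ⟨z, hz, hmax⟩ := p.toFinset.exists_max_image id ⟨b, by simpa using hb⟩
    have hzp : z ∈ p := by simpa using hz
    have hyz : y < z := hyb.trans_le (hmax b (by simpa using hb))
    set q := p.erase z
    have hperm : p.Perm (q ++ [z]) :=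
      (List.perm_cons_erase hzp).trans (List.perm_append_singleton z q).symm
    have hqlen : q.length + 1 = N := by rw [← hN, hperm.length_eq]; simp
    have hqle : ∀ a ∈ q, a ≤ z := fun a ha => hmax a (by simpa using List.mem_of_mem_erase ha)
    have hlen : ∀ a, (q ++ [a]).length + 2 ≤ n := fun a => by simp; omega
    -- With the maximal letter `z` moved last, the pseudo-braid relation trades `σ^{q,z,x,y}` for
    -- two symbols of the same length ending in `z`, hence dominated, and three shorter ones.
    refine perm p _ x y h (hlen z) hperm hN ?_
    have hdom : ∀ c d : Fin (k - 1), c < z → d < z → sigma ⟨q ++ [c], d, z, hlen c⟩ ∈ S := by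
      intro c d hc hd
      refine dominated _ d z _ (by simpa using hqlen) hd fun a ha => ?_
      rcases List.mem_append.1 ha with ha | ha
      · exact hqle a ha
      · rw [List.mem_singleton.1 ha]; exact hc.le
    have hlow : ∀ c d, sigma (⟨q, c, d, by omega⟩ : StarGen n k) ∈ S := fun c d =>
      ih _ (by simp; omega)
    have hbraid := sigma_pseudoBraid q x y z (by omega) (hlen x) (hlen y) (hlen z)
    rw [eq_inv_mul_of_mul_eq hbraid]
    exact S.mul_mem (S.inv_mem (S.mul_mem (hdom x y (hxy.trans hyz) hyz) (hlow x z)))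
      (S.mul_mem (S.mul_mem (hlow x y) (hdom y x hyz (hxy.trans hyz))) (hlow y z))
  rintro ⟨p, x, y, h⟩ hN
  rcases lt_trichotomy x y with hxy | rfl | hxy
  · exact increasing p x y h hN hxy
  · rw [sigma_diag]; exact S.one_mem
  · rw [← sigma_inv]; exact S.inv_mem (increasing p y x h hN hxy)

theorem ofFree_surjective : Function.Surjective (ofFree n k) := by
  rw [← MonoidHom.range_eq_top, eq_top_iff, ← PresentedGroup.closure_range_of,
    Subgroup.closure_le]
  rintro _ ⟨g, rfl⟩
  exact sigma_mem_of_basic (S := (ofFree n k).range)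
    (fun g hg => ⟨FreeGroup.of ⟨g, hg⟩, by simp [ofFree]⟩) _ g rfl

/-- `G_{n,k}` is free on the basic symbols. -/
noncomputable def equivFree (n k : ℕ) :
    FreeGroup {g : StarGen n k // g.IsBasic} ≃* StarGroup n k :=
  MulEquiv.ofBijective (ofFree n k)
    ⟨Function.LeftInverse.injective (g := toFree n k)
      (DFunLike.congr_fun toFree_comp_ofFree), ofFree_surjective⟩

/-- The basic symbols as a basis of `G_{n,k}`. -/
noncomputable def basicBasis (n k : ℕ) :
    FreeGroupBasis {g : StarGen n k // g.IsBasic} (StarGroup n k) :=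
  (FreeGroupBasis.ofFreeGroup _).map (equivFree n k)

theorem basicBasis_apply (g : {g : StarGen n k // g.IsBasic}) :
    basicBasis n k g = sigma g.1 := by
  change ofFree n k (FreeGroup.of g) = sigma g.1
  simp [ofFree]

end StarGroup

/-! ### Counting the basic symbols -/

namespace StarGen

variable {n k : ℕ}

/-- A basic symbol from the length of its initial part, its last two letters and the multiset of
the letters of its initial part. -/
noncomputable def basicOfData (n k : ℕ)
    (d : Σ l : Fin (n - 1), Σ y : Fin (k - 1), {x // x < y} × Sym {a // a ≤ y} l) :
    {g : StarGen n k // g.IsBasic} :=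
  ⟨⟨(d.2.2.2.1.map Subtype.val).sort (· ≤ ·), d.2.2.1, d.2.1, by
      have h1 := d.1.2
      have h2 := d.2.2.2.2
      simp only [Multiset.length_sort, Multiset.card_map, h2]
      omega⟩,
    by
      refine ⟨List.pairwise_append.2 ⟨Multiset.pairwise_sort _ _, by simp, ?_⟩, d.2.2.1.2⟩
      intro a ha b hb
      obtain ⟨c, -, rfl⟩ := Multiset.mem_map.1 ((Multiset.mem_sort _).1 ha)
      rw [List.mem_singleton.1 hb]
      exact c.2⟩

theorem basicOfData_bijective : Function.Bijective (basicOfData n k) := by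
  constructor
  · rintro ⟨l, y, x, s, hs⟩ ⟨l', y', x', s', hs'⟩ h
    simp only [basicOfData, Subtype.mk.injEq, StarGen.mk.injEq] at h
    obtain ⟨h1, h2, rfl⟩ := h
    have h3 : s.map Subtype.val = s'.map Subtype.val := by
      rw [← Multiset.sort_eq (s.map Subtype.val) (· ≤ ·), h1, Multiset.sort_eq]
    obtain rfl := Multiset.map_injective Subtype.val_injective h3
    obtain rfl : l = l' := Fin.ext (hs.symm.trans hs')
    obtain rfl := Subtype.ext h2
    rfl
  · rintro ⟨⟨p, x, y, hl⟩, hb⟩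
    obtain ⟨hs, hlt⟩ := id hb
    have hs' := List.pairwise_append.1 hs
    have hle : ∀ a ∈ p, a ≤ y := fun a ha => hs'.2.2 a ha _ (by simp)
    obtain ⟨P, hP⟩ : ∃ P : List {a // a ≤ y}, P.map Subtype.val = p :=
      ⟨p.attachWith _ hle, by simp⟩
    have hPl : P.length = p.length := by rw [← hP, List.length_map]
    refine ⟨⟨⟨p.length, by omega⟩, y, ⟨x, hlt⟩, ⟨(P : Multiset _), by simpa using hPl⟩⟩, ?_⟩
    refine Subtype.ext (StarGen.ext ?_ rfl rfl)
    change ((P : Multiset {a // a ≤ y}).map Subtype.val).sort (· ≤ ·) = p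
    refine List.Perm.eq_of_pairwise' (r := (· ≤ ·)) (Multiset.pairwise_sort _ (· ≤ ·)) hs'.1 ?_
    rw [← Multiset.coe_eq_coe, Multiset.sort_eq, Multiset.map_coe, hP]

/-- Each summand is `(l + 1) * (l + y).choose (l + 1)`, so this is a hockey-stick sum. It counts the
basic symbols with initial part of length `l` on `m` letters. -/
theorem sum_mul_multichoose (m l : ℕ) :
    ∑ y ∈ Finset.range m, y * (y + 1).multichoose l = (l + 1) * (l + m).choose (l + 2) := by
  induction m with
  | zero => simp [Nat.choose_eq_zero_of_lt]
  | succ m ih =>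
    have h := Nat.choose_succ_right_eq (l + m) l
    have e : (m + 1).multichoose l = (l + m).choose l := by
      rw [Nat.multichoose_eq]; congr 1; omega
    rw [Nat.add_sub_cancel_left] at h
    rw [Finset.sum_range_succ, ih, e, ← add_assoc l m 1, Nat.choose_succ_succ (l + m) (l + 1)]
    linarith

theorem sum_eq_starRank (r m : ℕ) :
    ((∑ l ∈ Finset.range r, (l + 1) * (l + m).choose (l + 2) : ℕ) : ℤ) =
      starRank (r + 1) (m + 1) := by
  have e : ∀ s, starRank (s + 1) (m + 1) =
      ((m : ℤ) - 1) * ((s + m).choose s : ℤ) - ((s + m).choose (s + 1) : ℤ) + 1 := fun s => by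
    rw [starRank, show s + 1 + (m + 1) - 2 = s + m by omega, Nat.add_sub_cancel]
    push_cast
    ring
  induction r with
  | zero => rw [e]; simp
  | succ r ih =>
    have h := Nat.choose_succ_right_eq (r + m) (r + 1)
    have h' : (((r + m).choose (r + 2) : ℕ) : ℤ) * (r + 2) =
        ((r + m).choose (r + 1) : ℤ) * ((m : ℤ) - 1) := by
      -- For `m = 0` the integer `m - 1` is not the natural subtraction, but both binomials vanish.
      rcases m with _ | m
      · simp [Nat.choose_eq_zero_of_lt]
      · rw [show r + (m + 1) - (r + 1) = m by omega] at h
        push_cast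
        rw [add_sub_cancel_right]
        exact_mod_cast h
    rw [Finset.sum_range_succ, Nat.cast_add, ih, e, e, show r + 1 + m = (r + m) + 1 by omega,
      Nat.choose_succ_succ (r + m) r, Nat.choose_succ_succ (r + m) (r + 1)]
    push_cast
    linear_combination h'

instance finite_isBasic : Finite {g : StarGen n k // g.IsBasic} :=
  Finite.of_surjective _ basicOfData_bijective.2

theorem card_isBasic (hn : 1 ≤ n) (hk : 1 ≤ k) :
    (Nat.card {g : StarGen n k // g.IsBasic} : ℤ) = starRank n k := by
  obtain ⟨r, rfl⟩ := Nat.exists_eq_add_of_le' hn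
  obtain ⟨m, rfl⟩ := Nat.exists_eq_add_of_le' hk
  rw [← sum_eq_starRank, ← Nat.card_eq_of_bijective _ basicOfData_bijective,
    Nat.card_eq_fintype_card, Fintype.card_sigma]
  simp only [Fintype.card_sigma, Fintype.card_prod, Sym.card_sym_eq_multichoose]
  congr 1
  rw [Finset.sum_range]
  refine Finset.sum_congr rfl fun l _ => ?_
  rw [← sum_mul_multichoose, Finset.sum_range]
  refine Finset.sum_congr rfl fun y _ => ?_
  congr 2
  · rw [Fintype.card_subtype, Finset.filter_gt_eq_Iio, Fin.card_Iio]
  · rw [Fintype.card_subtype, Finset.filter_ge_eq_Iic, Fin.card_Iic]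

end StarGen

theorem mainTheorem10 (n k : ℕ) (hn : 1 ≤ n) (hk : 1 ≤ k) :
    (∃ m : ℕ, (m : ℤ) = starRank n k ∧ Nonempty (StarGroup n k ≃* FreeGroup (Fin m))) ∧
    (∃ b : FreeGroupBasis {g : StarGen n k // g.IsBasic} (StarGroup n k),
      ∀ g : {g : StarGen n k // g.IsBasic}, b g = StarGroup.sigma g.1) :=
  ⟨⟨_, StarGen.card_isBasic hn hk,
    ⟨(StarGroup.equivFree n k).symm.trans (FreeGroup.freeGroupCongr (Finite.equivFin _))⟩⟩,
    StarGroup.basicBasis n k, StarGroup.basicBasis_apply⟩
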